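/- Let the standard Kagome lattice have vertices $A_{j,k}=j(2,0)+k(1,\sqrt3)$, $B_{j,k}=A_{j,k}+(\tfrac12,\tfrac{\sqrt3}{2})$, $C_{j,k}=A_{j,k}+(-\tfrac12,\tfrac{\sqrt3}{2})$ for $j,k\in\mathbb Z$. Its triangles are $\nabla_{j,k}=A_{j,k}B_{j,k}C_{j,k}$ and $\Delta_{j,k}=A_{j,k}B_{j,k-1}C_{j+1,k-1}$, and its springs are the (unit) sides of the triangles. The $k$-th layer consists of all $\Delta_{j,k},\nabla_{j,k}$, $j\in\mathbb Z$. A motion $u(x,t)\in\mathbb R^2$, $t\in[-t_0,t_0]$ with $t_0>0$, is a deformation of the vertices that is smooth in $t$, satisfies $u(x,0)=x$ and preserves the lengths of all springs; it is a mechanism if moreover $u(\cdot,t)$ is not a rigid motion for any $t\neq0$. It is $N$-by-one periodic (with period 1 in the horizontal direction) if $u(x,t)=F(t)x+\varphi(x,t)$ with $F(t)\in\mathbb R^{2\times2}$ invertible and $\varphi(\cdot,t)$ periodic with periods $(2,0)$ and $N(1,\sqrt3)$. A deformation $f$ is called periodic if for some $N\ge1$ it has the form $f(x)=Fx+\varphi(x)$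 with $F\in\mathbb R^{2\times2}$ and $\varphi$ periodic with periods $N(2,0)$ and $N(1,\sqrt3)$. For an angle $\theta$, the four layer types prescribe the counterclockwise rotation angles of ($\Delta_{j,k}$, $\nabla_{j,k}$): $G_1=(\theta,-\theta)$, $G_2=(-\theta,\theta)$, $W_1=(\theta,\theta)$, $W_2=(-\theta,-\theta)$. A deformation is stacked by a sequence $a=(a_k)_{k\in\mathbb Z}$ with angle $\theta$ if, for every $k$, it rotates (and translates) the triangles of the $k$-th layer as prescribed by $a_k$. The sequence is admissible if $a_k\to a_{k+1}$ for all $k$, where the layering relation is $$G_1\to G_1,W_1;\qquad G_2\to G_2,W_2;\qquad W_1\to G_2,W_2;\qquad W_2\to G_1,W_1 .$$ Then: 1. For $0<\theta<\pi/2$, a sequence $a$ is admissible if and only if there is a deformation $f$ stacked by $a$ with angle $\theta$ such that $f(x+(2,0))=f(x)+(2\cos\theta,0)$ for all vertices $x$. 2. Let $N\ge1$ and let $u$ be an $N$-by-one periodic motion, in particular any $N$-by-one periodic mechanism, on $[-t_0,t_0]$. Then there are a smooth $R:[-t_0,t_0]\to SO(2)$ and a continuous $\theta:[-t_0,t_0]\to[0,\pi/2)$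 such that for every $t$ the deformation $R(t)^{-1}u(\cdot,t)$ is stacked with angle $\theta(t)$ by an admissible sequence of period $N$. On every interval $J$ in which $u(\cdot,t)$ is never rigid, $\theta$ is smooth and one and the same sequence can be used for all $t\in J$. If the deformed triangles at time $t$ have pairwise disjoint interiors, then $\cos\theta(t)\ge\frac12$. 3. For every admissible sequence $a$, periodic or not, there is a $u(x,t)$ ($t\in\mathbb R$) such that $u(\cdot,t)$ is stacked by $a$ with angle $t$, which is a mechanism on $[-t_0,t_0]$ for every $0<t_0<\pi/2$, and which satisfies $u(x+(2,0),t)=u(x,t)+(2\cos t,0)$ and $|u(x,t)-\cos(t)\,x|\le1$ for all $x,t$ (macroscopic compression ratio $\cos t$). If $a$ has period $N\ge1$, then $u$ is $N$-by-one periodic on each such $[-t_0,t_0]$; if $a$ has no period, then $u(\cdot,t)$ is not periodic for any $t$ with $0<|t|<\pi/2$. 4. Every one-sided sequence $(a_n)_{n\ge0}$ with $a_n\to a_{n+1}$ for all $n$ extends to an admissible sequence indexed by $\mathbb Z$. 5. There is a $u(x,t)$ that is, for every $0<t_0<\pi/2$, a mechanism on $[-t_0,t_0]$ such that $u(\cdot,t)$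 is not periodic for any $0<|t|\le t_0$. -/

import Mathlib

open scoped ContDiff

/-! The plane `ℝ²` is identified with `ℂ` (same norm); rotations are multiplications by
complex numbers of modulus one. -/

namespace Kagome

noncomputable section

/-- The three vertices of the unit cell of the standard Kagome lattice. -/
inductive Site
  | A
  | B
  | C

/-- A vertex of the lattice: `(s, j, k)` is the copy of the site `s` in the cell reached from
the origin by `j` horizontal steps `(2, 0)` and `k` steps `(1, √3)` in the 60 degree direction. -/
abbrev Vertex : Type := Site × ℤ × ℤ

/-- The unit vector `(1/2, √3/2)` in the 60 degree direction. -/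
def ζ : ℂ := ⟨1 / 2, Real.sqrt 3 / 2⟩

/-- Position of a site relative to the origin of its cell: `A = (0, 0)`, `B = (1/2, √3/2)`,
`C = (-1/2, √3/2)`. -/
def Site.offset : Site → ℂ
  | .A => 0
  | .B => ζ
  | .C => ζ - 1

/-- Position of a vertex in the standard (reference) Kagome lattice with springs of length 1. -/
def pos (x : Vertex) : ℂ := 2 * (x.2.1 : ℂ) + 2 * (x.2.2 : ℂ) * ζ + x.1.offset

/-- Lattice translation by `m` horizontal steps `(2, 0)` and `n` steps `(1, √3)`. -/
def shift (m n : ℤ) (x : Vertex) : Vertex := (x.1, x.2.1 + m, x.2.2 + n)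

/-- The triangles of the lattice. `down j k` and `up j k` are the two triangles that share the
vertex `A` of the cell `(j, k)`: the first lies above that vertex, the second below it. -/
inductive Triangle
  | up (j k : ℤ)
  | down (j k : ℤ)

/-- The vertices of a triangle. -/
def Triangle.vertex : Triangle → Fin 3 → Vertex
  | .down j k => ![(.A, j, k), (.B, j, k), (.C, j, k)]
  | .up j k => ![(.A, j, k), (.B, j, k - 1), (.C, j + 1, k - 1)]

/-- The springs are the sides of the triangles. -/
def Spring (x y : Vertex) : Prop :=
  x ≠ y ∧ ∃ (T : Triangle) (i i' : Fin 3), x = T.vertex i ∧ y = T.vertex i'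

/-- A deformation is rigid if it preserves all distances. -/
def IsRigid (f : Vertex → ℂ) : Prop :=
  ∀ x y, ‖f x - f y‖ = ‖pos x - pos y‖

/-- A smooth zero-energy motion of the standard Kagome lattice for `t ∈ [-t₀, t₀]`: it starts at
the reference lattice and preserves the length of every spring. Rigid motions are allowed. -/
structure IsMotion (t₀ : ℝ) (u : Vertex → ℝ → ℂ) : Prop where
  pos_time : 0 < t₀
  smooth : ∀ x, ContDiffOn ℝ ∞ (u x) (Set.Icc (-t₀) t₀)
  start : ∀ x, u x 0 = pos x
  length : ∀ t ∈ Set.Icc (-t₀) t₀, ∀ x y, Spring x y → ‖u x t - u y t‖ = ‖pos x - pos y‖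

/-- A mechanism: a zero-energy motion that is not rigid at any time `t ≠ 0`. -/
structure IsMechanism (t₀ : ℝ) (u : Vertex → ℝ → ℂ) : Prop extends IsMotion t₀ u where
  not_rigid : ∀ t ∈ Set.Icc (-t₀) t₀, t ≠ 0 → ¬ IsRigid (fun x => u x t)

/-- `f x = F x + φ x` where `φ` has the periods `m • (2, 0)` and `n • (1, √3)`. -/
def HasPeriods (m n : ℕ) (F : ℂ →ₗ[ℝ] ℂ) (f : Vertex → ℂ) : Prop :=
  ∃ φ : Vertex → ℂ, (∀ x, f x = F (pos x) + φ x) ∧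
    (∀ x, φ (shift m 0 x) = φ x) ∧ (∀ x, φ (shift 0 n x) = φ x)

/-- `u(x, t) = F(t) x + φ(x, t)` with a nondegenerate macroscopic deformation gradient `F(t)` and
`φ` of period 1 in the horizontal direction and period `N` in the 60 degree direction. -/
def IsNByOnePeriodic (N : ℕ) (t₀ : ℝ) (u : Vertex → ℝ → ℂ) : Prop :=
  ∃ F : ℝ → (ℂ →ₗ[ℝ] ℂ), ∀ t ∈ Set.Icc (-t₀) t₀,
    Function.Injective (F t) ∧ HasPeriods 1 N (F t) (fun x => u x t)

/-- The deformed lattice is periodic: `f x = F x + φ x` with `φ` `N`-periodic in both lattice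
directions, for some `N ≥ 1`. -/
def IsPeriodicDeformation (f : Vertex → ℂ) : Prop :=
  ∃ (N : ℕ) (F : ℂ →ₗ[ℝ] ℂ), 1 ≤ N ∧ HasPeriods N N F f

/-- The deformed triangles do not overlap. -/
def NonOverlapping (f : Vertex → ℂ) : Prop :=
  ∀ S T : Triangle, S ≠ T →
    Disjoint (interior (convexHull ℝ (Set.range (fun i => f (S.vertex i)))))
      (interior (convexHull ℝ (Set.range (fun i => f (T.vertex i)))))

/-- The four types of layers. A layer is a horizontal row of pairs of triangles `up j k`,
`down j k` (`j ∈ ℤ`) joined at the vertices `A`. -/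
inductive Layer
  | G₁
  | G₂
  | W₁
  | W₂

/-- Counterclockwise rotation angle of the triangles `up j k` in a layer with angle `θ`. -/
def Layer.upAngle (θ : ℝ) : Layer → ℝ
  | .G₁ => θ
  | .W₁ => θ
  | .G₂ => -θ
  | .W₂ => -θ

/-- Counterclockwise rotation angle of the triangles `down j k` in a layer with angle `θ`. -/
def Layer.downAngle (θ : ℝ) : Layer → ℝ
  | .G₁ => -θ
  | .W₁ => θ
  | .G₂ => θ
  | .W₂ => -θ

/-- The layering relation `p → q`: a layer `q` fits above a layer `p`. -/
inductive Fits : Layer → Layer → Prop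
  | G₁G₁ : Fits .G₁ .G₁
  | G₁W₁ : Fits .G₁ .W₁
  | G₂G₂ : Fits .G₂ .G₂
  | G₂W₂ : Fits .G₂ .W₂
  | W₁G₂ : Fits .W₁ .G₂
  | W₁W₂ : Fits .W₁ .W₂
  | W₂G₁ : Fits .W₂ .G₁
  | W₂W₁ : Fits .W₂ .W₁

/-- A two-sided sequence of layers that obeys the layering relation. -/
def Admissible (a : ℤ → Layer) : Prop := ∀ k, Fits (a k) (a (k + 1))

/-- The deformation `f` rotates the triangle `T` by the angle `α` (and translates it). -/
def Rotates (f : Vertex → ℂ) (T : Triangle) (α : ℝ) : Prop :=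
  ∀ i i' : Fin 3, f (T.vertex i) - f (T.vertex i') =
    Complex.exp (α * Complex.I) * (pos (T.vertex i) - pos (T.vertex i'))

/-- `f` deforms the `k`-th row of triangles into a layer of type `a k`, for every `k`. -/
def IsStackedBy (a : ℤ → Layer) (θ : ℝ) (f : Vertex → ℂ) : Prop :=
  ∀ j k : ℤ, Rotates f (.up j k) ((a k).upAngle θ) ∧ Rotates f (.down j k) ((a k).downAngle θ)

end

end Kagome

namespace Kagome

noncomputable section

lemma zeta_re : ζ.re = 1 / 2 := rfl

lemma zeta_im : ζ.im = Real.sqrt 3 / 2 := rfl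

lemma zeta_mul_self : ζ * ζ = ζ - 1 := by
  have h := Real.mul_self_sqrt (show (0 : ℝ) ≤ 3 by norm_num)
  apply Complex.ext
  · simp only [Complex.mul_re, Complex.sub_re, Complex.one_re, zeta_re, zeta_im]
    nlinarith
  · simp only [Complex.mul_im, Complex.sub_im, Complex.one_im, zeta_re, zeta_im]
    ring

lemma zeta_ne_zero : ζ ≠ 0 := fun h => by
  have := congrArg Complex.re h
  rw [zeta_re] at this
  norm_num at this

lemma norm_eq_one_of_sq {z : ℂ} (h : z.re * z.re + z.im * z.im = 1) : ‖z‖ = 1 := by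
  rw [Complex.norm_def, Complex.normSq_apply, h, Real.sqrt_one]

lemma re_sq_add_im_sq {z : ℂ} (h : ‖z‖ = 1) : z.re * z.re + z.im * z.im = 1 := by
  rw [← Complex.normSq_apply, Complex.normSq_eq_norm_sq, h, one_pow]

lemma norm_zeta : ‖ζ‖ = 1 := by
  have h := Real.mul_self_sqrt (show (0 : ℝ) ≤ 3 by norm_num)
  apply norm_eq_one_of_sq
  rw [zeta_re, zeta_im]
  nlinarith

lemma norm_zeta_sub_one : ‖ζ - 1‖ = 1 := by
  rw [← zeta_mul_self, norm_mul, norm_zeta, one_mul]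

/-- `f` acts on the triangle `T` as multiplication by `r` followed by a translation. -/
def ActsOn (f : Vertex → ℂ) (T : Triangle) (r : ℂ) : Prop :=
  ∀ i i' : Fin 3, f (T.vertex i) - f (T.vertex i') =
    r * (pos (T.vertex i) - pos (T.vertex i'))

lemma actsOn_down_iff {f : Vertex → ℂ} {j k : ℤ} {r : ℂ} :
    ActsOn f (.down j k) r ↔ f (.B, j, k) - f (.A, j, k) = r * ζ ∧
      f (.C, j, k) - f (.A, j, k) = r * (ζ - 1) := by
  constructor
  · intro h
    have h1 := h 1 0
    have h2 := h 2 0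
    simp [Triangle.vertex, pos, Site.offset] at h1 h2
    exact ⟨h1, h2⟩
  · rintro ⟨h1, h2⟩ i i'
    fin_cases i <;> fin_cases i' <;> simp [Triangle.vertex, pos, Site.offset]
    · linear_combination -h1
    · linear_combination -h2
    · linear_combination h1
    · linear_combination h1 - h2
    · linear_combination h2
    · linear_combination h2 - h1

lemma actsOn_up_iff {f : Vertex → ℂ} {j k : ℤ} {r : ℂ} :
    ActsOn f (.up j k) r ↔ f (.A, j, k) - f (.B, j, k - 1) = r * ζ ∧
      f (.A, j, k) - f (.C, j + 1, k - 1) = r * (ζ - 1) := by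
  constructor
  · intro h
    have h1 := h 0 1
    have h2 := h 0 2
    simp [Triangle.vertex, pos, Site.offset] at h1 h2
    exact ⟨by linear_combination h1, by linear_combination h2⟩
  · rintro ⟨h1, h2⟩ i i'
    fin_cases i <;> fin_cases i' <;> simp [Triangle.vertex, pos, Site.offset]
    · linear_combination h1
    · linear_combination h2
    · linear_combination -h1
    · linear_combination h2 - h1
    · linear_combination -h2
    · linear_combination h1 - h2

lemma rotates_iff_actsOn {f : Vertex → ℂ} {T : Triangle} {α : ℝ} :
    Rotates f T α ↔ ActsOn f T (Complex.exp (α * Complex.I)) := Iff.rfl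

lemma ActsOn.const_mul {f : Vertex → ℂ} {T : Triangle} {r : ℂ} (h : ActsOn f T r) (c : ℂ) :
    ActsOn (fun x => c * f x) T (c * r) := fun i i' => by
  have := h i i'
  linear_combination c * this

lemma ActsOn.length {f : Vertex → ℂ} {T : Triangle} {r : ℂ} (h : ActsOn f T r) (hr : ‖r‖ = 1)
    (i i' : Fin 3) :
    ‖f (T.vertex i) - f (T.vertex i')‖ = ‖pos (T.vertex i) - pos (T.vertex i')‖ := by
  rw [h i i', norm_mul, hr, one_mul]

/-- The compatibility condition along a horizontal line of the lattice. -/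
lemma add_eq_of_shift {f : Vertex → ℂ} {h q p : ℂ} {j k : ℤ}
    (hf : ∀ x, f (shift 1 0 x) = f x + h) (hq : ActsOn f (.down j k) q)
    (hp : ActsOn f (.up j (k + 1)) p) : q + p = h := by
  obtain ⟨h1, h2⟩ := actsOn_down_iff.1 hq
  obtain ⟨h3, h4⟩ := actsOn_up_iff.1 hp
  have h5 := hf (.C, j, k)
  simp only [shift, add_zero, add_sub_cancel_right] at h3 h4 h5
  linear_combination h4 - h3 + h2 - h1 + h5

lemma ActsOn.down_of_shift {f : Vertex → ℂ} {h q : ℂ} {k : ℤ}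
    (hf : ∀ x, f (shift 1 0 x) = f x + h) (hq : ActsOn f (.down 0 k) q) (j : ℤ) :
    ActsOn f (.down j k) q := by
  have key : ∀ j : ℤ, ActsOn f (.down j k) q ↔ ActsOn f (.down (j + 1) k) q := fun j => by
    have hA := hf (.A, j, k)
    have hB := hf (.B, j, k)
    have hC := hf (.C, j, k)
    simp only [shift, add_zero] at hA hB hC
    rw [actsOn_down_iff, actsOn_down_iff, hA, hB, hC, add_sub_add_right_eq_sub,
      add_sub_add_right_eq_sub]
  induction j using Int.induction_on with
  | zero => exact hq
  | succ i ih => exact (key _).1 ih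
  | pred i ih => exact (key _).2 (by rwa [sub_add_cancel])

lemma ActsOn.up_of_shift {f : Vertex → ℂ} {h p : ℂ} {k : ℤ}
    (hf : ∀ x, f (shift 1 0 x) = f x + h) (hp : ActsOn f (.up 0 k) p) (j : ℤ) :
    ActsOn f (.up j k) p := by
  have key : ∀ j : ℤ, ActsOn f (.up j k) p ↔ ActsOn f (.up (j + 1) k) p := fun j => by
    have hA := hf (.A, j, k)
    have hB := hf (.B, j, k - 1)
    have hC := hf (.C, j + 1, k - 1)
    simp only [shift, add_zero] at hA hB hC
    rw [actsOn_up_iff, actsOn_up_iff, hA, hB, hC, add_sub_add_right_eq_sub,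
      add_sub_add_right_eq_sub]
  induction j using Int.induction_on with
  | zero => exact hp
  | succ i ih => exact (key _).1 ih
  | pred i ih => exact (key _).2 (by rwa [sub_add_cancel])

/-! ### Layers and signs -/

lemma exp_mul_I_re (α : ℝ) : (Complex.exp (α * Complex.I)).re = Real.cos α :=
  Complex.exp_ofReal_mul_I_re α

lemma exp_mul_I_im (α : ℝ) : (Complex.exp (α * Complex.I)).im = Real.sin α :=
  Complex.exp_ofReal_mul_I_im α

/-- The angle `θ` or `-θ`, according to a sign. -/
def signed (θ : ℝ) (s : Bool) : ℝ := if s then θ else -θ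

/-- The layer whose `up` triangles rotate by `-signed θ s` and whose `down` triangles rotate by
`signed θ s'`. -/
def Layer.ofSigns : Bool → Bool → Layer
  | false, false => .G₁
  | true, true => .G₂
  | false, true => .W₁
  | true, false => .W₂

/-- The sign of the rotation of the `down` triangles. -/
def Layer.sign : Layer → Bool
  | .G₁ => false
  | .G₂ => true
  | .W₁ => true
  | .W₂ => false

lemma Layer.upAngle_ofSigns (θ : ℝ) (s s' : Bool) :
    (Layer.ofSigns s s').upAngle θ = -signed θ s := by
  cases s <;> cases s' <;> simp [Layer.ofSigns, Layer.upAngle, signed]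

lemma Layer.downAngle_ofSigns (θ : ℝ) (s s' : Bool) :
    (Layer.ofSigns s s').downAngle θ = signed θ s' := by
  cases s <;> cases s' <;> simp [Layer.ofSigns, Layer.downAngle, signed]

lemma Layer.downAngle_eq (θ : ℝ) (p : Layer) : p.downAngle θ = signed θ p.sign := by
  cases p <;> simp [Layer.sign, Layer.downAngle, signed]

lemma fits_iff (p q : Layer) : Fits p q ↔ q = Layer.ofSigns p.sign q.sign := by
  constructor
  · rintro ⟨⟩ <;> rfl
  · cases p <;> cases q <;> simp [Layer.ofSigns, Layer.sign] <;> constructor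

lemma sign_ofSigns (s s' : Bool) : (Layer.ofSigns s s').sign = s' := by
  cases s <;> cases s' <;> rfl

lemma admissible_ofSigns (s : ℤ → Bool) :
    Admissible (fun k => Layer.ofSigns (s (k - 1)) (s k)) := fun k => by
  simp only [fits_iff, sign_ofSigns, add_sub_cancel_right]

lemma Admissible.eq_ofSigns {a : ℤ → Layer} (ha : Admissible a) (k : ℤ) :
    a k = Layer.ofSigns (a (k - 1)).sign (a k).sign := by
  have := ha (k - 1)
  rwa [sub_add_cancel, fits_iff] at this

lemma Admissible.upAngle_succ {a : ℤ → Layer} (ha : Admissible a) (θ : ℝ) (k : ℤ) :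
    (a (k + 1)).upAngle θ = -(a k).downAngle θ := by
  rw [ha.eq_ofSigns (k + 1), Layer.upAngle_ofSigns, Layer.downAngle_eq, add_sub_cancel_right]

lemma fits_of_sin_eq {p q : Layer} {θ : ℝ} (hθ : Real.sin θ ≠ 0)
    (h : Real.sin (p.downAngle θ) + Real.sin (q.upAngle θ) = 0) : Fits p q := by
  have h2 : Real.sin θ + Real.sin θ ≠ 0 := fun h => hθ (by linarith)
  have h3 : -Real.sin θ + -Real.sin θ ≠ 0 := fun h => hθ (by linarith)
  cases p <;> cases q <;>
    simp only [Layer.downAngle, Layer.upAngle, Real.sin_neg] at h <;>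
    first
    | exact absurd h h2
    | exact absurd h h3
    | constructor

/-! ### The mechanism of an admissible sequence -/

/-- The deformation stacked by an admissible sequence `a` with angle `t`. -/
def stack (a : ℤ → Layer) (x : Vertex) (t : ℝ) : ℂ :=
  2 * (Real.cos t : ℂ) * (x.2.1 + x.2.2 * ζ) +
    Complex.exp ((a x.2.2).downAngle t * Complex.I) * x.1.offset

lemma exp_add_exp_neg (α : ℝ) :
    Complex.exp (α * Complex.I) + Complex.exp ((-α : ℝ) * Complex.I) = 2 * (Real.cos α : ℂ) := by
  rw [Complex.ofReal_cos, Complex.two_cos]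
  push_cast
  rfl

lemma cos_signed (θ : ℝ) (s : Bool) : Real.cos (signed θ s) = Real.cos θ := by
  cases s <;> simp [signed]

lemma sin_signed (θ : ℝ) (s : Bool) :
    Real.sin (signed θ s) = if s then Real.sin θ else -Real.sin θ := by
  cases s <;> simp [signed]

lemma cos_downAngle (θ : ℝ) (p : Layer) : Real.cos (p.downAngle θ) = Real.cos θ := by
  rw [Layer.downAngle_eq, cos_signed]

lemma isStackedBy_stack {a : ℤ → Layer} (ha : Admissible a) (t : ℝ) :
    IsStackedBy a t (fun x => stack a x t) := by
  intro j k
  rw [rotates_iff_actsOn, rotates_iff_actsOn, actsOn_up_iff, actsOn_down_iff]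
  have h1 := ha.upAngle_succ t (k - 1)
  rw [sub_add_cancel] at h1
  have h2 := exp_add_exp_neg ((a (k - 1)).downAngle t)
  rw [← h1, cos_downAngle] at h2
  simp only [stack, Site.offset]
  push_cast
  refine ⟨⟨?_, ?_⟩, ?_, ?_⟩
  · push_cast at h2
    linear_combination (-ζ) * h2
  · push_cast at h2
    linear_combination (1 - ζ) * h2
  · ring
  · ring

lemma stack_shift (a : ℤ → Layer) (x : Vertex) (t : ℝ) :
    stack a (shift 1 0 x) t = stack a x t + ((2 * Real.cos t : ℝ) : ℂ) := by
  simp only [stack, shift, add_zero]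
  push_cast
  ring

lemma stack_sub_cos_mul_pos (a : ℤ → Layer) (x : Vertex) (t : ℝ) :
    stack a x t - (Real.cos t : ℂ) * pos x =
      (Real.sin ((a x.2.2).downAngle t) : ℂ) * Complex.I * x.1.offset := by
  have : Complex.exp ((a x.2.2).downAngle t * Complex.I) =
      Real.cos t + Real.sin ((a x.2.2).downAngle t) * Complex.I := by
    rw [Complex.exp_mul_I, ← Complex.ofReal_cos, ← Complex.ofReal_sin, cos_downAngle]
  rw [stack, pos, this]
  ring

lemma norm_offset_le (s : Site) : ‖s.offset‖ ≤ 1 := by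
  cases s
  · simp [Site.offset]
  · exact norm_zeta.le
  · exact norm_zeta_sub_one.le

lemma norm_stack_sub_le (a : ℤ → Layer) (x : Vertex) (t : ℝ) :
    ‖stack a x t - (Real.cos t : ℂ) * pos x‖ ≤ 1 := by
  rw [stack_sub_cos_mul_pos, norm_mul, norm_mul, Complex.norm_I, mul_one, Complex.norm_real]
  exact mul_le_one₀ (Real.abs_sin_le_one _) (norm_nonneg _) (norm_offset_le _)

lemma contDiff_downAngle (p : Layer) : ContDiff ℝ ∞ (fun t => p.downAngle t) := by
  cases p <;> simp only [Layer.downAngle] <;> fun_prop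

lemma contDiff_stack (a : ℤ → Layer) (x : Vertex) : ContDiff ℝ ∞ (stack a x) := by
  have h1 : ContDiff ℝ ∞ (fun t : ℝ => ((Real.cos t : ℝ) : ℂ)) :=
    Complex.ofRealCLM.contDiff.comp Real.contDiff_cos
  have h2 : ContDiff ℝ ∞ (fun t : ℝ => (((a x.2.2).downAngle t : ℝ) : ℂ)) :=
    Complex.ofRealCLM.contDiff.comp (contDiff_downAngle _)
  have h3 : ContDiff ℝ ∞ (fun t : ℝ => Complex.exp ((a x.2.2).downAngle t * Complex.I)) :=
    (h2.mul contDiff_const).cexp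
  exact ((contDiff_const.mul h1).mul contDiff_const).add (h3.mul contDiff_const)

lemma stack_zero (a : ℤ → Layer) (x : Vertex) : stack a x 0 = pos x := by
  have : (a x.2.2).downAngle 0 = 0 := by cases a x.2.2 <;> simp [Layer.downAngle]
  rw [stack, this, pos]
  simp
  ring

lemma IsStackedBy.length {a : ℤ → Layer} {θ : ℝ} {f : Vertex → ℂ} (h : IsStackedBy a θ f)
    {x y : Vertex} (hxy : Spring x y) : ‖f x - f y‖ = ‖pos x - pos y‖ := by
  obtain ⟨-, T, i, i', rfl, rfl⟩ := hxy
  cases T with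
  | up j k => exact ActsOn.length (h j k).1 (Complex.norm_exp_ofReal_mul_I _) i i'
  | down j k => exact ActsOn.length (h j k).2 (Complex.norm_exp_ofReal_mul_I _) i i'

lemma cos_pos_of_abs_lt {t : ℝ} (h : |t| < Real.pi / 2) : 0 < Real.cos t :=
  Real.cos_pos_of_mem_Ioo (abs_lt.1 h)

lemma sin_ne_zero_of_abs_lt {t : ℝ} (h0 : t ≠ 0) (h : |t| < Real.pi / 2) : Real.sin t ≠ 0 := by
  obtain ⟨h1, h2⟩ := abs_lt.1 h
  have := Real.pi_pos
  intro hs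
  exact h0 ((Real.sin_eq_zero_iff_of_lt_of_lt (by linarith) (by linarith)).1 hs)

lemma not_isRigid_stack (a : ℤ → Layer) {t : ℝ} (h0 : t ≠ 0) (h : |t| < Real.pi / 2) :
    ¬ IsRigid (fun x => stack a x t) := by
  intro hr
  have h1 := hr (.A, 1, 0) (.A, 0, 0)
  have h2 := cos_pos_of_abs_lt h
  have h3 := sin_ne_zero_of_abs_lt h0 h
  simp [stack, pos, Site.offset] at h1
  rw [← Complex.ofReal_cos, Complex.norm_real, Real.norm_eq_abs, abs_of_pos h2] at h1
  have := Real.sin_sq_add_cos_sq t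
  rw [h1] at this
  exact h3 (pow_eq_zero_iff (two_ne_zero) |>.1 (by linarith))

lemma isMechanism_stack {a : ℤ → Layer} (ha : Admissible a) {t₀ : ℝ} (h0 : 0 < t₀)
    (h1 : t₀ < Real.pi / 2) : IsMechanism t₀ (stack a) where
  pos_time := h0
  smooth x := (contDiff_stack a x).contDiffOn
  start := stack_zero a
  length t _ _ _ hxy := (isStackedBy_stack ha t).length hxy
  not_rigid _ ht h := not_isRigid_stack a h ((abs_le.2 ht).trans_lt h1)

lemma isNByOnePeriodic_stack {a : ℤ → Layer} {N : ℕ} (hN : ∀ k, a (k + N) = a k) {t₀ : ℝ}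
    (h1 : t₀ < Real.pi / 2) : IsNByOnePeriodic N t₀ (stack a) := by
  refine ⟨fun t => Real.cos t • LinearMap.id, fun t ht => ⟨fun z w h => ?_, ?_⟩⟩
  · have := (cos_pos_of_abs_lt ((abs_le.2 ht).trans_lt h1)).ne'
    simpa [this, -Complex.ofReal_cos] using h
  · refine ⟨fun x => Real.sin ((a x.2.2).downAngle t) * Complex.I * x.1.offset, fun x => ?_,
      fun x => ?_, fun x => ?_⟩
    · have := stack_sub_cos_mul_pos a x t
      simp only [LinearMap.smul_apply, LinearMap.id_apply, Complex.real_smul]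
      linear_combination this
    · simp [shift]
    · simp only [shift, hN]

lemma not_isPeriodicDeformation_stack {a : ℤ → Layer} (ha : Admissible a)
    (hN : ¬ ∃ N : ℕ, 1 ≤ N ∧ ∀ k, a (k + N) = a k) {t : ℝ} (h0 : t ≠ 0)
    (h : |t| < Real.pi / 2) : ¬ IsPeriodicDeformation (fun x => stack a x t) := by
  rintro ⟨N, F, hN1, φ, hφ, -, hv⟩
  refine hN ⟨N, hN1, ?_⟩
  have hs := sin_ne_zero_of_abs_lt h0 h
  have key : ∀ k, (a (k + N)).sign = (a k).sign := fun k => by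
    have hA := hv (.A, 0, k)
    have hB := hv (.B, 0, k)
    have e1 := hφ (.A, 0, k)
    have e2 := hφ (.B, 0, k)
    have e3 := hφ (shift 0 N (.A, 0, k))
    have e4 := hφ (shift 0 N (.B, 0, k))
    rw [hA] at e3
    rw [hB] at e4
    have e5 : pos (.B, 0, k) = pos (.A, 0, k) + ζ := by simp [pos, Site.offset]
    have e6 : pos (shift 0 N (.B, 0, k)) = pos (shift 0 N (.A, 0, k)) + ζ := by
      simp [pos, Site.offset, shift]
    rw [e5, map_add] at e2
    rw [e6, map_add] at e4
    have e7 : Complex.exp ((a (k + N)).downAngle t * Complex.I) * ζ =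
        Complex.exp ((a k).downAngle t * Complex.I) * ζ := by
      simp only [stack, shift, Site.offset, mul_zero, add_zero] at e1 e2 e3 e4
      linear_combination e4 - e3 - e2 + e1
    have e8 := congrArg Complex.im (mul_right_cancel₀ zeta_ne_zero e7)
    rw [exp_mul_I_im, exp_mul_I_im, Layer.downAngle_eq, Layer.downAngle_eq, sin_signed,
      sin_signed] at e8
    have h2 : Real.sin t ≠ -Real.sin t := fun h => hs (by linarith)
    cases h5 : (a (k + N)).sign <;> cases h6 : (a k).sign <;> simp [h5, h6] at e8 ⊢
    · exact h2 e8.symm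
    · exact h2 e8
  intro k
  rw [ha.eq_ofSigns (k + N), ha.eq_ofSigns k, key, show k + N - 1 = k - 1 + N by ring, key]

lemma admissible_of_isStackedBy {a : ℤ → Layer} {θ : ℝ} (hs : Real.sin θ ≠ 0) {f : Vertex → ℂ}
    (hf : IsStackedBy a θ f) (hp : ∀ x, f (shift 1 0 x) = f x + ((2 * Real.cos θ : ℝ) : ℂ)) :
    Admissible a := fun k => by
  have h := congrArg Complex.im (add_eq_of_shift hp (hf 0 k).2 (hf 0 (k + 1)).1)
  rw [Complex.add_im, exp_mul_I_im, exp_mul_I_im, Complex.ofReal_im] at h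
  exact fits_of_sin_eq hs h

lemma exists_extension (a : ℕ → Layer) (ha : ∀ n, Fits (a n) (a (n + 1))) :
    ∃ b : ℤ → Layer, Admissible b ∧ ∀ n : ℕ, b n = a n := by
  obtain ⟨g, hg, hg0⟩ : ∃ g, Fits g g ∧ Fits g (a 0) := by
    cases a 0
    · exact ⟨.G₁, .G₁G₁, .G₁G₁⟩
    · exact ⟨.G₂, .G₂G₂, .G₂G₂⟩
    · exact ⟨.G₁, .G₁G₁, .G₁W₁⟩
    · exact ⟨.G₂, .G₂G₂, .G₂W₂⟩
  refine ⟨fun k => if 0 ≤ k then a k.toNat else g, fun k => ?_, fun n => by simp⟩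
  rcases lt_trichotomy k (-1) with h | rfl | h
  · simpa [show ¬ 0 ≤ k by omega, show ¬ 0 ≤ k + 1 by omega] using hg
  · simpa using hg0
  · lift k to ℕ using by omega
    simpa [show (0 : ℤ) ≤ k + 1 by omega] using ha k

/-- A single domain wall between the two uniform states. -/
lemma exists_admissible_not_periodic :
    ∃ a : ℤ → Layer, Admissible a ∧ ¬ ∃ N : ℕ, 1 ≤ N ∧ ∀ k, a (k + N) = a k := by
  refine ⟨_, admissible_ofSigns (fun k => decide (0 ≤ k)), ?_⟩
  rintro ⟨N, hN, h⟩
  have h1 := congrArg Layer.sign (h (-1))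
  simp only [sign_ofSigns] at h1
  have : (0 : ℤ) ≤ -1 + N := by omega
  simp [this] at h1

/-! ### Structure of periodic motions -/

lemma pos_of_preconnected {J : Set ℝ} (hJ : IsPreconnected J) {g : ℝ → ℝ}
    (hg : ContinuousOn g J) (h0 : ∀ t ∈ J, g t ≠ 0) {a b : ℝ} (ha : a ∈ J) (hb : b ∈ J)
    (h : 0 < g a) : 0 < g b := by
  by_contra! hb'
  obtain ⟨c, hc, hc0⟩ := hJ.intermediate_value hb ha hg ⟨hb', h.le⟩
  exact h0 c hc hc0

/-- An equilateral triangle of side one is positively or negatively oriented. -/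
lemma re_im_of_norm_eq_one {w : ℂ} (h1 : ‖w‖ = 1) (h2 : ‖w - 1‖ = 1) :
    w.re = 1 / 2 ∧ w.im * w.im = 3 / 4 := by
  have e1 := re_sq_add_im_sq h1
  have e2 := re_sq_add_im_sq h2
  simp only [Complex.sub_re, Complex.sub_im, Complex.one_re, Complex.one_im, sub_zero] at e2
  have : w.re = 1 / 2 := by linarith
  refine ⟨this, ?_⟩
  rw [this] at e1
  linarith

lemma eq_zeta {w : ℂ} (h1 : ‖w‖ = 1) (h2 : ‖w - 1‖ = 1) (h3 : 0 < w.im) : w = ζ := by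
  obtain ⟨e1, e2⟩ := re_im_of_norm_eq_one h1 h2
  apply Complex.ext
  · rw [e1, zeta_re]
  · rw [zeta_im]
    have h := Real.mul_self_sqrt (show (0 : ℝ) ≤ 3 by norm_num)
    have h' := Real.sqrt_nonneg 3
    nlinarith

lemma Triangle.vertex_injective (T : Triangle) : Function.Injective T.vertex := by
  cases T <;> intro i i' <;> fin_cases i <;> fin_cases i' <;> simp [Triangle.vertex]

/-- The displacement vectors of a triangle from its vertex `A`. -/
lemma Triangle.exists_pos_sub (T : Triangle) : ∃ σ : ℂ, ‖σ‖ = 1 ∧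
    pos (T.vertex 1) - pos (T.vertex 0) = σ ∧ pos (T.vertex 2) - pos (T.vertex 0) = ζ * σ := by
  cases T with
  | up j k =>
    refine ⟨-ζ, by rw [norm_neg, norm_zeta], ?_, ?_⟩
    · simp [Triangle.vertex, pos, Site.offset]; ring
    · simp [Triangle.vertex, pos, Site.offset]; linear_combination zeta_mul_self
  | down j k =>
    refine ⟨ζ, norm_zeta, ?_, ?_⟩
    · simp [Triangle.vertex, pos, Site.offset]
    · simp [Triangle.vertex, pos, Site.offset]; linear_combination -zeta_mul_self

lemma actsOn_of_sub {f : Vertex → ℂ} {T : Triangle} {r : ℂ}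
    (h1 : f (T.vertex 1) - f (T.vertex 0) = r * (pos (T.vertex 1) - pos (T.vertex 0)))
    (h2 : f (T.vertex 2) - f (T.vertex 0) = r * (pos (T.vertex 2) - pos (T.vertex 0))) :
    ActsOn f T r := by
  intro i i'
  fin_cases i <;> fin_cases i' <;> simp
  · linear_combination -h1
  · linear_combination -h2
  · linear_combination h1
  · linear_combination h1 - h2
  · linear_combination h2
  · linear_combination h2 - h1

/-- Motions cannot reflect triangles. -/
lemma IsMotion.exists_actsOn {t₀ : ℝ} {u : Vertex → ℝ → ℂ} (hu : IsMotion t₀ u) (T : Triangle)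
    {t : ℝ} (ht : t ∈ Set.Icc (-t₀) t₀) : ∃ r : ℂ, ‖r‖ = 1 ∧ ActsOn (fun x => u x t) T r := by
  obtain ⟨σ, hσ, e1, e2⟩ := T.exists_pos_sub
  have hσ0 : σ ≠ 0 := fun h => by simp [h] at hσ
  have hlen : ∀ i i' : Fin 3, i ≠ i' → ∀ t ∈ Set.Icc (-t₀) t₀,
      ‖u (T.vertex i) t - u (T.vertex i') t‖ = ‖pos (T.vertex i) - pos (T.vertex i')‖ :=
    fun i i' h t ht => hu.length t ht _ _ ⟨fun h' => h (T.vertex_injective h'), T, i, i', rfl, rfl⟩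
  have d1 : ∀ t ∈ Set.Icc (-t₀) t₀, ‖u (T.vertex 1) t - u (T.vertex 0) t‖ = 1 := fun t ht => by
    rw [hlen 1 0 (by decide) t ht, e1, hσ]
  have d2 : ∀ t ∈ Set.Icc (-t₀) t₀, ‖u (T.vertex 2) t - u (T.vertex 0) t‖ = 1 := fun t ht => by
    rw [hlen 2 0 (by decide) t ht, e2, norm_mul, norm_zeta, hσ, one_mul]
  have d3 : ∀ t ∈ Set.Icc (-t₀) t₀, ‖u (T.vertex 2) t - u (T.vertex 1) t‖ = 1 := fun t ht => by
    rw [hlen 2 1 (by decide) t ht,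
      show pos (T.vertex 2) - pos (T.vertex 1) = (ζ - 1) * σ by linear_combination e2 - e1,
      norm_mul, norm_zeta_sub_one, hσ, one_mul]
  have n0 : ∀ t ∈ Set.Icc (-t₀) t₀, u (T.vertex 1) t - u (T.vertex 0) t ≠ 0 := fun t ht h => by
    have := d1 t ht
    simp [h] at this
  let w : ℝ → ℂ := fun t =>
    (u (T.vertex 2) t - u (T.vertex 0) t) / (u (T.vertex 1) t - u (T.vertex 0) t)
  have hc : ∀ x, ContinuousOn (u x) (Set.Icc (-t₀) t₀) := fun x => (hu.smooth x).continuousOn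
  have hw : ContinuousOn w (Set.Icc (-t₀) t₀) :=
    ((hc _).sub (hc _)).div ((hc _).sub (hc _)) n0
  have w1 : ∀ t ∈ Set.Icc (-t₀) t₀, ‖w t‖ = 1 := fun t ht => by
    simp only [w]
    rw [norm_div, d1 t ht, d2 t ht, div_one]
  have w2 : ∀ t ∈ Set.Icc (-t₀) t₀, ‖w t - 1‖ = 1 := fun t ht => by
    simp only [w]
    rw [div_sub_one (n0 t ht), norm_div, d1 t ht, sub_sub_sub_cancel_right, d3 t ht, div_one]
  have h0 : (0 : ℝ) ∈ Set.Icc (-t₀) t₀ := ⟨by linarith [hu.pos_time], hu.pos_time.le⟩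
  have w0 : w 0 = ζ := by
    simp only [w, hu.start]
    rw [e1, e2, mul_div_cancel_right₀ _ hσ0]
  have him : 0 < (w t).im := by
    refine pos_of_preconnected isPreconnected_Icc
      (Complex.continuous_im.comp_continuousOn hw) (fun s hs h => ?_) h0 ht ?_
    · have := (re_im_of_norm_eq_one (w1 s hs) (w2 s hs)).2
      simp only [Function.comp_apply] at h
      rw [h] at this
      norm_num at this
    · simp only [Function.comp_apply]
      rw [w0, zeta_im]
      positivity
  have hwt := eq_zeta (w1 t ht) (w2 t ht) him
  refine ⟨(u (T.vertex 1) t - u (T.vertex 0) t) / σ, by rw [norm_div, d1 t ht, hσ, div_one],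
    actsOn_of_sub ?_ ?_⟩
  · rw [e1, div_mul_cancel₀ _ hσ0]
  · rw [e2]
    have : u (T.vertex 2) t - u (T.vertex 0) t = ζ * (u (T.vertex 1) t - u (T.vertex 0) t) := by
      rw [← hwt, div_mul_cancel₀ _ (n0 t ht)]
    rw [this]
    field_simp

/-- Two unit vectors whose sum is a positive real number are complex conjugate. -/
lemma re_im_of_add_eq {p q : ℂ} {c : ℝ} (hc : 0 < c) (hp : ‖p‖ = 1) (hq : ‖q‖ = 1)
    (h : q + p = ((2 * c : ℝ) : ℂ)) : q.re = c ∧ p.re = c ∧ p.im = -q.im := by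
  have e1 := re_sq_add_im_sq hp
  have e2 := re_sq_add_im_sq hq
  have h1 := congrArg Complex.re h
  have h2 := congrArg Complex.im h
  rw [Complex.add_re, Complex.ofReal_re] at h1
  rw [Complex.add_im, Complex.ofReal_im] at h2
  have h3 : p.im = -q.im := by linarith
  rw [h3] at e1
  have h4 : (q.re - p.re) * (2 * c) = 0 := by rw [← h1]; linarith
  have h5 : q.re - p.re = 0 := (mul_eq_zero.1 h4).resolve_right (by linarith)
  exact ⟨by linarith, by linarith, h3⟩

lemma eq_exp_signed {q : ℂ} {θ : ℝ} (hs : 0 ≤ Real.sin θ) (hq : ‖q‖ = 1)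
    (hre : q.re = Real.cos θ) :
    q = Complex.exp (signed θ (decide (0 < q.im)) * Complex.I) := by
  have e := re_sq_add_im_sq hq
  rw [hre] at e
  have e2 := Real.sin_sq_add_cos_sq θ
  have h : (q.im - Real.sin θ) * (q.im + Real.sin θ) = 0 := by nlinarith
  apply Complex.ext
  · rw [exp_mul_I_re, cos_signed, hre]
  · rw [exp_mul_I_im, sin_signed]
    by_cases hi : 0 < q.im
    · simp only [hi, decide_true, if_true]
      rcases mul_eq_zero.1 h with h | h <;> linarith
    · simp only [hi, decide_false, Bool.false_eq_true, if_false]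
      rcases mul_eq_zero.1 h with h | h <;> linarith

/-- The rotation of the `down` triangles of the `k`-th layer, if there is one. -/
def downRot (f : Vertex → ℂ) (k : ℤ) : ℂ := (f (.B, 0, k) - f (.A, 0, k)) / ζ

lemma ActsOn.eq_downRot {f : Vertex → ℂ} {k : ℤ} {q : ℂ} (h : ActsOn f (.down 0 k) q) :
    q = downRot f k := by
  rw [downRot, (actsOn_down_iff.1 h).1, mul_div_cancel_right₀ _ zeta_ne_zero]

/-- The sequence of layers of a deformation with the compression direction `(1, 0)`. -/
def layers (g : Vertex → ℂ) (k : ℤ) : Layer :=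
  Layer.ofSigns (decide (0 < (downRot g (k - 1)).im)) (decide (0 < (downRot g k).im))

lemma admissible_layers (g : Vertex → ℂ) : Admissible (layers g) :=
  admissible_ofSigns fun k => decide (0 < (downRot g k).im)

lemma isStackedBy_layers {g : Vertex → ℂ} {θ : ℝ} (hs : 0 ≤ Real.sin θ) (hc : 0 < Real.cos θ)
    (hg : ∀ x, g (shift 1 0 x) = g x + ((2 * Real.cos θ : ℝ) : ℂ))
    (hT : ∀ T, ∃ r : ℂ, ‖r‖ = 1 ∧ ActsOn g T r) : IsStackedBy (layers g) θ g := by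
  intro j k
  obtain ⟨q, hq, hqk⟩ := hT (.down 0 k)
  obtain ⟨p', hp', hpk'⟩ := hT (.up 0 (k + 1))
  obtain ⟨q', hq', hqk'⟩ := hT (.down 0 (k - 1))
  obtain ⟨p, hp, hpk⟩ := hT (.up 0 k)
  have e1 := add_eq_of_shift hg hqk hpk'
  have e2 := add_eq_of_shift hg hqk' (by rwa [sub_add_cancel])
  obtain ⟨a1, -, -⟩ := re_im_of_add_eq hc hp' hq e1
  obtain ⟨b1, b2, b3⟩ := re_im_of_add_eq hc hp hq' e2
  have ea := eq_exp_signed hs hq a1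
  have eb := eq_exp_signed hs hq' b1
  rw [rotates_iff_actsOn, rotates_iff_actsOn, layers, Layer.upAngle_ofSigns,
    Layer.downAngle_ofSigns, ← hqk.eq_downRot, ← hqk'.eq_downRot]
  constructor
  · have : p = Complex.exp ((-signed θ (decide (0 < q'.im)) : ℝ) * Complex.I) := by
      have := exp_add_exp_neg (signed θ (decide (0 < q'.im)))
      rw [← eb, cos_signed] at this
      push_cast at this e2 ⊢
      linear_combination e2 - this
    rw [← this]
    exact hpk.up_of_shift hg j
  · rw [← ea]
    exact hqk.down_of_shift hg j

lemma sub_eq_of_isStackedBy_zero {a : ℤ → Layer} {g : Vertex → ℂ} (h : IsStackedBy a 0 g)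
    (x y : Vertex) : g x - g y = pos x - pos y := by
  have hd : ∀ j k, ActsOn g (.down j k) 1 := fun j k => by
    have := (h j k).2
    rw [rotates_iff_actsOn, Layer.downAngle_eq] at this
    cases h : (a k).sign <;> simpa [h, signed] using this
  have hu : ∀ j k, ActsOn g (.up j k) 1 := fun j k => by
    have := (h j k).1
    rw [rotates_iff_actsOn] at this
    cases h : a k <;> simpa [h, Layer.upAngle] using this
  have cB : ∀ j k, g (.B, j, k) = g (.A, j, k) + ζ := fun j k => by
    linear_combination (actsOn_down_iff.1 (hd j k)).1
  have cC : ∀ j k, g (.C, j, k) = g (.A, j, k) + (ζ - 1) := fun j k => by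
    linear_combination (actsOn_down_iff.1 (hd j k)).2
  have s1 : ∀ j k, g (.A, j, k + 1) = g (.A, j, k) + 2 * ζ := fun j k => by
    have := (actsOn_up_iff.1 (hu j (k + 1))).1
    rw [add_sub_cancel_right, cB] at this
    linear_combination this
  have s2 : ∀ j k, g (.A, j + 1, k) = g (.A, j, k) + 2 := fun j k => by
    have := (actsOn_up_iff.1 (hu j (k + 1))).2
    rw [add_sub_cancel_right, cC, s1] at this
    linear_combination -this
  have iter : ∀ (v : ℤ → ℂ) (c : ℂ), (∀ j, v (j + 1) = v j + c) → ∀ j, v j = v 0 + j * c := by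
    intro v c hv j
    induction j using Int.induction_on with
    | zero => simp
    | succ i ih => rw [hv, ih]; push_cast; ring
    | pred i ih =>
      have := hv (-i - 1)
      rw [sub_add_cancel, ih] at this
      push_cast at this ⊢
      linear_combination -this
  have hA : ∀ j k, g (.A, j, k) = g (.A, 0, 0) + 2 * j + 2 * k * ζ := fun j k => by
    rw [iter (fun j => g (.A, j, k)) 2 (fun j => s2 j k) j,
      iter (fun k => g (.A, 0, k)) (2 * ζ) (fun k => s1 0 k) k]
    ring
  have all : ∀ x, g x = pos x + g (.A, 0, 0) := by
    rintro ⟨s, j, k⟩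
    cases s
    · rw [hA]; simp only [pos, Site.offset]; ring
    · rw [cB, hA]; simp only [pos, Site.offset]; ring
    · rw [cC, hA]; simp only [pos, Site.offset]; ring
  rw [all x, all y]
  ring

/-! ### Overlapping triangles -/

lemma mem_interior_convexHull {z b c : ℂ} (q : ℂ) (hq : q ≠ 0) {x y : ℝ} (hx : 0 < x)
    (hy : 0 < y) (hxy : x + y < 1) (hb : b = z + q * ζ) (hc : c = z + q * (ζ - 1)) :
    z + q * (x * ζ + y * (ζ - 1)) ∈ interior (convexHull ℝ {z, b, c}) := by
  have h3 : (0 : ℝ) < Real.sqrt 3 := by positivity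
  let X : ℂ → ℝ := fun w => ((w - z) / q).im / Real.sqrt 3 + ((w - z) / q).re
  let Y : ℂ → ℝ := fun w => ((w - z) / q).im / Real.sqrt 3 - ((w - z) / q).re
  have hX : Continuous X := by fun_prop
  have hY : Continuous Y := by fun_prop
  have hwz : ∀ w, w = z + q * (X w * ζ + Y w * (ζ - 1)) := fun w => by
    have : (w - z) / q = X w * ζ + Y w * (ζ - 1) := by
      apply Complex.ext
      · simp [X, Y, zeta_re, zeta_im]
        ring
      · simp [X, Y, zeta_re, zeta_im]
        field_simp
        ring
    rw [← this, mul_div_cancel₀ _ hq]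
    ring
  refine mem_interior.2 ⟨{w | 0 < X w} ∩ {w | 0 < Y w} ∩ {w | X w + Y w < 1}, ?_, ?_, ?_⟩
  · rintro w ⟨⟨h1, h2⟩, h⟩
    simp only [Set.mem_ofPred_eq] at h1 h2 h
    have hz : z ∈ convexHull ℝ {z, b, c} := subset_convexHull ℝ _ (by simp)
    have hb' : b ∈ convexHull ℝ {z, b, c} := subset_convexHull ℝ _ (by simp)
    have hc' : c ∈ convexHull ℝ {z, b, c} := subset_convexHull ℝ _ (by simp)
    have key := (convex_convexHull ℝ {z, b, c}).sum_mem (t := Finset.univ)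
      (w := ![1 - X w - Y w, X w, Y w]) (z := ![z, b, c])
      (fun i _ => by fin_cases i <;> simp <;> linarith)
      (by simp [Fin.sum_univ_three]; ring)
      (fun i _ => by fin_cases i <;> simpa)
    rw [hwz w]
    convert key using 1
    simp [Fin.sum_univ_three, hb, hc]
    ring
  · exact ((isOpen_lt continuous_const hX).inter (isOpen_lt continuous_const hY)).inter
      (isOpen_lt (hX.add hY) continuous_const)
  · have e : (z + q * (x * ζ + y * (ζ - 1)) - z) / q = x * ζ + y * (ζ - 1) := by
      field_simp
      ring
    have eX : X (z + q * (x * ζ + y * (ζ - 1))) = x := by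
      simp only [X, e]
      simp [zeta_re, zeta_im]
      field_simp
      ring
    have eY : Y (z + q * (x * ζ + y * (ζ - 1))) = y := by
      simp only [Y, e]
      simp [zeta_re, zeta_im]
      field_simp
      ring
    simp only [Set.mem_inter_iff, Set.mem_ofPred_eq, eX, eY]
    exact ⟨⟨hx, hy⟩, hxy⟩

lemma range_down (f : Vertex → ℂ) (j k : ℤ) :
    Set.range (fun i => f ((Triangle.down j k).vertex i)) =
      {f (.A, j, k), f (.B, j, k), f (.C, j, k)} := by
  ext z
  simp [Triangle.vertex, Fin.exists_fin_succ, eq_comm]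

/-- Two triangles of the same row overlap if their distance is small. -/
lemma not_nonOverlapping {f : Vertex → ℂ} {q : ℂ} (hq : q ≠ 0) {j j' k : ℤ} (hj : j ≠ j')
    (h1 : ActsOn f (.down j k) q) (h2 : ActsOn f (.down j' k) q) {α β : ℝ} (hα : 0 < α)
    (hβ : 0 < β) (hαβ : α + β < 1)
    (h : f (.A, j', k) - f (.A, j, k) = q * (α * ζ + β * (ζ - 1))) : ¬ NonOverlapping f := by
  intro hn
  have hd := hn (.down j k) (.down j' k) (by simpa using hj)
  rw [range_down, range_down] at hd
  obtain ⟨b1, c1⟩ := actsOn_down_iff.1 h1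
  obtain ⟨b2, c2⟩ := actsOn_down_iff.1 h2
  have m1 := mem_interior_convexHull (z := f (.A, j, k)) (b := f (.B, j, k)) (c := f (.C, j, k))
    q hq (x := α + (1 - α - β) / 3) (y := β + (1 - α - β) / 3) (by linarith) (by linarith)
    (by linarith) (by linear_combination b1) (by linear_combination c1)
  have m2 := mem_interior_convexHull (z := f (.A, j', k)) (b := f (.B, j', k)) (c := f (.C, j', k))
    q hq (x := (1 - α - β) / 3) (y := (1 - α - β) / 3) (by linarith) (by linarith)
    (by linarith) (by linear_combination b2) (by linear_combination c2)
  refine Set.disjoint_left.1 hd m1 ?_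
  convert m2 using 1
  push_cast
  linear_combination -h

lemma cos_ge_of_nonOverlapping {f : Vertex → ℂ} {R : ℂ} (hR : R ≠ 0) {a : ℤ → Layer} {θ : ℝ}
    (hs : 0 ≤ Real.sin θ) (hc : 0 < Real.cos θ)
    (hf : ∀ x, f (shift 1 0 x) = f x + R * ((2 * Real.cos θ : ℝ) : ℂ))
    (ha : IsStackedBy a θ (fun x => R⁻¹ * f x)) (hn : NonOverlapping f) :
    1 / 2 ≤ Real.cos θ := by
  by_contra! hlt
  set e := Complex.exp ((a 0).downAngle θ * Complex.I) with he
  have act : ∀ j, ActsOn f (.down j 0) (R * e) := fun j => by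
    have := (rotates_iff_actsOn.1 (ha j 0).2).const_mul R
    simpa [mul_inv_cancel_left₀ hR] using this
  have he0 : e ≠ 0 := Complex.exp_ne_zero _
  have hA := hf (.A, 0, 0)
  simp only [shift, zero_add, add_zero] at hA
  have r3 : (0 : ℝ) < Real.sqrt 3 := by positivity
  have r3' := Real.mul_self_sqrt (show (0 : ℝ) ≤ 3 by norm_num)
  have sq := Real.sin_sq_add_cos_sq θ
  set c := Real.cos θ
  set s := Real.sin θ
  have hs3 : Real.sqrt 3 / 2 < s := by nlinarith
  have hcs : c * Real.sqrt 3 < s := by nlinarith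
  have hcs2 : 4 * (c * s) < Real.sqrt 3 := by
    have h4 : c ^ 2 < 1 / 4 := by nlinarith
    have : (4 * (c * s)) ^ 2 < Real.sqrt 3 ^ 2 := by nlinarith
    exact lt_of_pow_lt_pow_left₀ 2 r3.le this
  have hα : 0 < 2 * c * (s / Real.sqrt 3 + c) := by positivity
  have hβ : 0 < 2 * c * (s / Real.sqrt 3 - c) := by
    have : c < s / Real.sqrt 3 := by rwa [lt_div_iff₀ r3]
    have := sub_pos.2 this
    positivity
  have hαβ : 2 * c * (s / Real.sqrt 3 + c) + 2 * c * (s / Real.sqrt 3 - c) < 1 := by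
    have : 2 * c * (s / Real.sqrt 3 + c) + 2 * c * (s / Real.sqrt 3 - c) =
      4 * (c * s) / Real.sqrt 3 := by ring
    rw [this, div_lt_one r3]
    exact hcs2
  have ere : e.re = c := by rw [he, exp_mul_I_re, cos_downAngle]
  have eim : e.im = if (a 0).sign then s else -s := by
    rw [he, exp_mul_I_im, Layer.downAngle_eq, sin_signed]
  cases hsig : (a 0).sign
  · rw [hsig] at eim
    refine not_nonOverlapping (mul_ne_zero hR he0) (show (0 : ℤ) ≠ 1 by norm_num) (act 0) (act 1)
      hα hβ hαβ ?_ hn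
    rw [hA, mul_assoc, add_sub_cancel_left]
    congr 1
    apply Complex.ext
    · simp [zeta_re, zeta_im, ere, eim, -Complex.ofReal_cos, -Complex.ofReal_sin]
      field_simp
      nlinarith
    · simp [zeta_re, zeta_im, ere, eim, -Complex.ofReal_cos, -Complex.ofReal_sin]
      field_simp
      nlinarith
  · rw [hsig] at eim
    refine not_nonOverlapping (mul_ne_zero hR he0) (show (1 : ℤ) ≠ 0 by norm_num) (act 1) (act 0)
      hβ hα (by linarith) ?_ hn
    rw [hA, mul_assoc, sub_add_cancel_left, ← mul_neg]
    congr 1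
    apply Complex.ext
    · simp [zeta_re, zeta_im, ere, eim, -Complex.ofReal_cos, -Complex.ofReal_sin]
      field_simp
      nlinarith
    · simp [zeta_re, zeta_im, ere, eim, -Complex.ofReal_cos, -Complex.ofReal_sin]
      field_simp
      nlinarith

/-! ### Main structure theorem -/

lemma IsNByOnePeriodic.exists_shift {N : ℕ} {t₀ : ℝ} {u : Vertex → ℝ → ℂ}
    (hp : IsNByOnePeriodic N t₀ u) {t : ℝ} (ht : t ∈ Set.Icc (-t₀) t₀) :
    ∃ h v : ℂ, h ≠ 0 ∧ (∀ x, u (shift 1 0 x) t = u x t + h) ∧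
      ∀ x, u (shift 0 N x) t = u x t + v := by
  obtain ⟨F, hF⟩ := hp
  obtain ⟨hinj, φ, hφ, h1, h2⟩ := hF t ht
  replace hφ : ∀ x, u x t = F t (pos x) + φ x := hφ
  have e1 : ∀ x, pos (shift 1 0 x) = pos x + 2 := fun x => by
    simp only [pos, shift]; push_cast; ring
  have e2 : ∀ x, pos (shift 0 N x) = pos x + 2 * N * ζ := fun x => by
    simp only [pos, shift]; push_cast; ring
  refine ⟨F t 2, F t (2 * N * ζ), fun h => ?_, fun x => ?_, fun x => ?_⟩
  · exact two_ne_zero (hinj (h.trans (map_zero (F t)).symm))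
  · have := h1 x
    rw [Nat.cast_one] at this
    rw [hφ, hφ x, this, e1, map_add]
    ring
  · rw [hφ, hφ x, h2, e2, map_add]
    ring

lemma layers_periodic {g : Vertex → ℂ} {N : ℕ} {v : ℂ}
    (hv : ∀ x, g (shift 0 N x) = g x + v) (k : ℤ) : layers g (k + N) = layers g k := by
  have key : ∀ k : ℤ, downRot g (k + N) = downRot g k := fun k => by
    have hA := hv (.A, 0, k)
    have hB := hv (.B, 0, k)
    simp only [shift, add_zero] at hA hB
    rw [downRot, downRot, hA, hB, add_sub_add_right_eq_sub]
  rw [layers, layers, key, show k + N - 1 = k - 1 + N by ring, key]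

theorem IsMotion.exists_stacking {N : ℕ} {t₀ : ℝ} {u : Vertex → ℝ → ℂ} (hu : IsMotion t₀ u)
    (hp : IsNByOnePeriodic N t₀ u) :
    ∃ (R : ℝ → ℂ) (θ : ℝ → ℝ),
      ContDiffOn ℝ ∞ R (Set.Icc (-t₀) t₀) ∧ ContinuousOn θ (Set.Icc (-t₀) t₀) ∧
      (∀ t ∈ Set.Icc (-t₀) t₀, ‖R t‖ = 1 ∧ 0 ≤ θ t ∧ θ t < Real.pi / 2 ∧
        (NonOverlapping (fun x => u x t) → 1 / 2 ≤ Real.cos (θ t)) ∧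
        ∃ a : ℤ → Layer, Admissible a ∧ (∀ k, a (k + N) = a k) ∧
          IsStackedBy a (θ t) (fun x => (R t)⁻¹ * u x t)) ∧
      (∀ J : Set ℝ, J ⊆ Set.Icc (-t₀) t₀ → J.OrdConnected →
        (∀ t ∈ J, ¬ IsRigid (fun x => u x t)) →
        ContDiffOn ℝ ∞ θ J ∧
        ∃ a : ℤ → Layer, Admissible a ∧ (∀ k, a (k + N) = a k) ∧
          ∀ t ∈ J, IsStackedBy a (θ t) (fun x => (R t)⁻¹ * u x t)) := by
  set I := Set.Icc (-t₀) t₀ with hI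
  let h : ℝ → ℂ := fun t => u (.A, 1, 0) t - u (.A, 0, 0) t
  have hsmooth : ContDiffOn ℝ ∞ h I := (hu.smooth _).sub (hu.smooth _)
  have hshift : ∀ t ∈ I, h t ≠ 0 ∧ (∀ x, u (shift 1 0 x) t = u x t + h t) ∧
      ∃ v, ∀ x, u (shift 0 N x) t = u x t + v := fun t ht => by
    obtain ⟨h', v, h0, h1, h2⟩ := hp.exists_shift ht
    have : h t = h' := by
      have := h1 (.A, 0, 0)
      simp only [shift, zero_add, add_zero] at this
      simp only [h, this, add_sub_cancel_left]
    rw [this]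
    exact ⟨h0, h1, v, h2⟩
  have hnorm : ContDiffOn ℝ ∞ (fun t => ‖h t‖) I := hsmooth.norm ℝ fun t ht => (hshift t ht).1
  have hpos : ∀ t ∈ I, 0 < ‖h t‖ := fun t ht => norm_pos_iff.2 (hshift t ht).1
  have hle : ∀ t ∈ I, ‖h t‖ ≤ 2 := fun t ht => by
    obtain ⟨q, hq, hqk⟩ := hu.exists_actsOn (.down 0 0) ht
    obtain ⟨p, hp, hpk⟩ := hu.exists_actsOn (.up 0 (0 + 1)) ht
    rw [← add_eq_of_shift (hshift t ht).2.1 hqk hpk]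
    linarith [norm_add_le q p]
  let R : ℝ → ℂ := fun t => h t / (‖h t‖ : ℂ)
  let θ : ℝ → ℝ := fun t => Real.arccos (‖h t‖ / 2)
  have hRn : ∀ t ∈ I, ‖R t‖ = 1 := fun t ht => by
    simp only [R]
    rw [norm_div, Complex.norm_real, norm_norm, div_self (hpos t ht).ne']
  have hR0 : ∀ t ∈ I, R t ≠ 0 := fun t ht h => by
    have := hRn t ht
    simp [h] at this
  have hcos : ∀ t ∈ I, Real.cos (θ t) = ‖h t‖ / 2 := fun t ht =>
    Real.cos_arccos (by linarith [hpos t ht]) (by linarith [hle t ht])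
  have hcpos : ∀ t ∈ I, 0 < Real.cos (θ t) := fun t ht => by
    rw [hcos t ht]
    linarith [hpos t ht]
  have hsin : ∀ t, 0 ≤ Real.sin (θ t) := fun t =>
    Real.sin_nonneg_of_nonneg_of_le_pi (Real.arccos_nonneg _) (Real.arccos_le_pi _)
  have hRh : ∀ t ∈ I, h t = R t * ((2 * Real.cos (θ t) : ℝ) : ℂ) := fun t ht => by
    rw [hcos t ht, mul_div_cancel₀ _ (two_ne_zero), div_mul_cancel₀]
    exact_mod_cast (hpos t ht).ne'
  have hRs : ContDiffOn ℝ ∞ R I := by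
    have hn : ContDiffOn ℝ ∞ (fun t => (‖h t‖ : ℂ)) I :=
      Complex.ofRealCLM.contDiff.comp_contDiffOn hnorm
    simp only [R, div_eq_mul_inv]
    exact hsmooth.mul (hn.inv fun t ht => by exact_mod_cast (hpos t ht).ne')
  have hθc : ContinuousOn θ I :=
    Real.continuous_arccos.comp_continuousOn (hnorm.continuousOn.div_const 2)
  let g : ℝ → Vertex → ℂ := fun t x => (R t)⁻¹ * u x t
  have hg1 : ∀ t ∈ I, ∀ x, g t (shift 1 0 x) = g t x + ((2 * Real.cos (θ t) : ℝ) : ℂ) :=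
    fun t ht x => by
      simp only [g]
      rw [(hshift t ht).2.1 x, hRh t ht, mul_add, inv_mul_cancel_left₀ (hR0 t ht)]
  have hg2 : ∀ t ∈ I, ∀ k, layers (g t) (k + N) = layers (g t) k := fun t ht => by
    obtain ⟨v, hv⟩ := (hshift t ht).2.2
    exact layers_periodic (v := (R t)⁻¹ * v) fun x => by simp only [g]; rw [hv, mul_add]
  have hgT : ∀ t ∈ I, ∀ T, ∃ r : ℂ, ‖r‖ = 1 ∧ ActsOn (g t) T r := fun t ht T => by
    obtain ⟨r, hr, hT⟩ := hu.exists_actsOn T ht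
    exact ⟨_, by rw [norm_mul, norm_inv, hRn t ht, hr, inv_one, one_mul], hT.const_mul (R t)⁻¹⟩
  have hgs : ∀ t ∈ I, IsStackedBy (layers (g t)) (θ t) (g t) := fun t ht =>
    isStackedBy_layers (hsin t) (hcpos t ht) (hg1 t ht) (hgT t ht)
  refine ⟨R, θ, hRs, hθc, fun t ht => ⟨hRn t ht, Real.arccos_nonneg _, ?_, fun hn => ?_,
    layers (g t), admissible_layers _, hg2 t ht, hgs t ht⟩, fun J hJI hJ hnr => ?_⟩
  · exact Real.arccos_lt_pi_div_two.2 (by linarith [hpos t ht])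
  · exact cos_ge_of_nonOverlapping (hR0 t ht) (hsin t) (hcpos t ht)
      (fun x => by rw [← hRh t ht]; exact (hshift t ht).2.1 x) (hgs t ht) hn
  · have hlt : ∀ t ∈ J, ‖h t‖ / 2 < 1 := fun t ht => by
      refine lt_of_le_of_ne (by linarith [hle t (hJI ht)]) fun h1 => hnr t ht fun x y => ?_
      have h0 : θ t = 0 := by simp only [θ, h1, Real.arccos_one]
      have hs := hgs t (hJI ht)
      rw [h0] at hs
      have := sub_eq_of_isStackedBy_zero hs x y
      rw [← this]
      simp only [g]
      rw [← mul_sub, norm_mul, norm_inv, hRn t (hJI ht), inv_one, one_mul]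
    have hsJ : ∀ t ∈ J, Real.sin (θ t) ≠ 0 := fun t ht h0 => by
      have e1 := Real.sin_sq_add_cos_sq (θ t)
      rw [h0, hcos t (hJI ht)] at e1
      nlinarith [hlt t ht, hpos t (hJI ht)]
    constructor
    · intro t ht
      refine ContDiffAt.comp_contDiffWithinAt t (g := Real.arccos)
        (Real.contDiffAt_arccos ?_ ?_) (((hnorm.mono hJI) t ht).div_const 2)
      · linarith [hpos t (hJI ht)]
      · exact (hlt t ht).ne
    · rcases J.eq_empty_or_nonempty with rfl | ⟨t₁, ht₁⟩
      · exact ⟨layers (g 0), admissible_layers _,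
          hg2 0 ⟨by linarith [hu.pos_time], hu.pos_time.le⟩, fun t ht => ht.elim⟩
      refine ⟨layers (g t₁), admissible_layers _, hg2 t₁ (hJI ht₁), fun t ht => ?_⟩
      have hpre : IsPreconnected J := hJ.isPreconnected
      have hcont : ∀ k, ContinuousOn (fun t => (downRot (g t) k).im) J := fun k => by
        have hc : ∀ x, ContinuousOn (fun t => g t x) J := fun x =>
          ((hRs.continuousOn.inv₀ hR0).mul (hu.smooth x).continuousOn).mono hJI
        exact Complex.continuous_im.comp_continuousOn (((hc _).sub (hc _)).div_const ζ)
      have hne : ∀ k, ∀ t ∈ J, (downRot (g t) k).im ≠ 0 := fun k t ht h0 => by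
        have e := (rotates_iff_actsOn.1 (hgs t (hJI ht) 0 k).2).eq_downRot
        rw [← e, exp_mul_I_im, Layer.downAngle_eq, sin_signed] at h0
        have := hsJ t ht
        split_ifs at h0
        · exact this h0
        · exact this (neg_eq_zero.1 h0)
      have hsign : ∀ k, (0 < (downRot (g t₁) k).im) = (0 < (downRot (g t) k).im) := fun k =>
        propext ⟨pos_of_preconnected hpre (hcont k) (hne k) ht₁ ht,
          pos_of_preconnected hpre (hcont k) (hne k) ht ht₁⟩
      have : layers (g t₁) = layers (g t) := by
        funext k
        simp only [layers, hsign]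
      rw [this]
      exact hgs t (hJI ht)

end

end Kagome

open Kagome in
theorem mainTheorem10 :
    -- the layers of a sequence fit together along horizontal zigzag lines with the compression
    -- ratio `cos θ` exactly when the sequence obeys the layering relation
    (∀ (a : ℤ → Layer) (θ : ℝ), 0 < θ → θ < Real.pi / 2 →
      (Admissible a ↔ ∃ f : Vertex → ℂ, IsStackedBy a θ f ∧
        ∀ x, f (shift 1 0 x) = f x + ((2 * Real.cos θ : ℝ) : ℂ))) ∧
    -- every `N`-by-one periodic mechanism is, up to rotations (and translations), a stack of layers
    (∀ (N : ℕ) (t₀ : ℝ) (u : Vertex → ℝ → ℂ), 1 ≤ N → IsMotion t₀ u → IsNByOnePeriodic N t₀ u →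
      ∃ (R : ℝ → ℂ) (θ : ℝ → ℝ),
        ContDiffOn ℝ ∞ R (Set.Icc (-t₀) t₀) ∧ ContinuousOn θ (Set.Icc (-t₀) t₀) ∧
        (∀ t ∈ Set.Icc (-t₀) t₀, ‖R t‖ = 1 ∧ 0 ≤ θ t ∧ θ t < Real.pi / 2 ∧
          (NonOverlapping (fun x => u x t) → 1 / 2 ≤ Real.cos (θ t)) ∧
          ∃ a : ℤ → Layer, Admissible a ∧ (∀ k, a (k + N) = a k) ∧
            IsStackedBy a (θ t) (fun x => (R t)⁻¹ * u x t)) ∧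
        -- one sequence serves for a whole time interval in which the lattice is never rigid
        (∀ J : Set ℝ, J ⊆ Set.Icc (-t₀) t₀ → J.OrdConnected →
          (∀ t ∈ J, ¬ IsRigid (fun x => u x t)) →
          ContDiffOn ℝ ∞ θ J ∧
          ∃ a : ℤ → Layer, Admissible a ∧ (∀ k, a (k + N) = a k) ∧
            ∀ t ∈ J, IsStackedBy a (θ t) (fun x => (R t)⁻¹ * u x t))) ∧
    -- every admissible sequence, periodic or not, gives a mechanism
    (∀ a : ℤ → Layer, Admissible a →
      ∃ u : Vertex → ℝ → ℂ,
        (∀ t₀ : ℝ, 0 < t₀ → t₀ < Real.pi / 2 → IsMechanism t₀ u) ∧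
        (∀ t, IsStackedBy a t (fun x => u x t)) ∧
        (∀ x t, u (shift 1 0 x) t = u x t + ((2 * Real.cos t : ℝ) : ℂ)) ∧
        (∀ x t, ‖u x t - (Real.cos t : ℂ) * pos x‖ ≤ 1) ∧
        (∀ N : ℕ, 1 ≤ N → (∀ k, a (k + N) = a k) →
          ∀ t₀ : ℝ, 0 < t₀ → t₀ < Real.pi / 2 → IsNByOnePeriodic N t₀ u) ∧
        ((¬ ∃ N : ℕ, 1 ≤ N ∧ ∀ k, a (k + N) = a k) →
          ∀ t : ℝ, t ≠ 0 → |t| < Real.pi / 2 → ¬ IsPeriodicDeformation (fun x => u x t))) ∧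
    -- a one-sided admissible sequence is the upper half of a two-sided one
    (∀ a : ℕ → Layer, (∀ n, Fits (a n) (a (n + 1))) →
      ∃ b : ℤ → Layer, Admissible b ∧ ∀ n : ℕ, b n = a n) ∧
    -- non-periodic mechanisms exist
    (∃ u : Vertex → ℝ → ℂ, ∀ t₀ : ℝ, 0 < t₀ → t₀ < Real.pi / 2 → IsMechanism t₀ u ∧
      ∀ t ∈ Set.Icc (-t₀) t₀, t ≠ 0 → ¬ IsPeriodicDeformation (fun x => u x t)) := by
  refine ⟨fun a θ h0 h1 => ⟨fun ha => ?_, ?_⟩, fun N t₀ u _ hu hp => hu.exists_stacking hp,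
    fun a ha => ?_, exists_extension, ?_⟩
  · exact ⟨fun x => stack a x θ, isStackedBy_stack ha θ, fun x => stack_shift a x θ⟩
  · rintro ⟨f, hf, hp⟩
    exact admissible_of_isStackedBy
      (Real.sin_pos_of_pos_of_lt_pi h0 (by linarith [Real.pi_pos])).ne' hf hp
  · exact ⟨stack a, fun t₀ h0 h1 => isMechanism_stack ha h0 h1, isStackedBy_stack ha,
      stack_shift a, norm_stack_sub_le a, fun N _ hN t₀ _ h1 => isNByOnePeriodic_stack hN h1,
      fun hN t h0 h => not_isPeriodicDeformation_stack ha hN h0 h⟩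
  · obtain ⟨a, ha, hN⟩ := exists_admissible_not_periodic
    exact ⟨stack a, fun t₀ h0 h1 => ⟨isMechanism_stack ha h0 h1, fun t ht h =>
      not_isPeriodicDeformation_stack ha hN h ((abs_le.2 ht).trans_lt h1)⟩⟩
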